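/- Let $E\to M$ be a smooth real vector bundle of finite rank over a smooth finite-dimensional manifold, with a fixed smooth fibrewise non-degenerate symmetric bilinear form $\langle\cdot,\cdot\rangle$ (of any signature). A Courant structure on $E$ (with this scalar product) is a pair $(\rho,[\cdot,\cdot])$ of a bundle map $\rho:E\to TM$ and an $\mathbb R$-bilinear skew-symmetric bracket on $\Gamma(E)$ such that, with $\mathcal D:C^\infty(M)\to\Gamma(E)$ defined by $\langle\mathcal Df,X\rangle=\rho(X)f$ and $T(X,Y,Z)=\frac16\langle[X,Y],Z\rangle+\mathrm{c.p.}$, for all $X,Y,Z\in\Gamma(E)$ and $f\in C^\infty(M)$: $[[X,Y],Z]+\mathrm{c.p.}=\mathcal D\,T(X,Y,Z)$; $\ \rho[X,Y]=[\rho X,\rho Y]$; $\ [X,fY]=f[X,Y]+(\rho(X)f)Y-\frac12\langle X,Y\rangle\mathcal Df$; $\ \rho\circ\mathcal D=0$; $\ \rho(X)\langle Y,Z\rangle=\langle[X,Y]+\frac12\mathcal D\langle X,Y\rangle,Z\rangle+\langle Y,[X,Z]+\frac12\mathcal D\langle X,Z\rangle\rangle$. Its associated Lie 2-algebra is the graded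 vector space $V=C^\infty(M)\oplus\Gamma(E)$, with $C^\infty(M)$ in degree $-2$ and $\Gamma(E)$ in degree $-1$, with the graded symmetric vector valued forms $l_1f=\mathcal Df$, $l_2(X,Y)=[X,Y]$, $l_2(X,f)=l_2(f,X)=\frac12\langle X,\mathcal Df\rangle$, $l_3(X,Y,Z)=T(X,Y,Z)$, all other values being $0$. For graded symmetric vector valued forms $K$ ($k$-linear, of degree $\bar K$) and $L$ ($l$-linear, of degree $\bar L$) on $V$, the Richardson–Nijenhuis bracket is $[K,L]_{RN}=\iota_KL-(-1)^{\bar K\bar L}\iota_LK$, where $$\iota_KL(x_1,\dots,x_{k+l-1})=\sum_{\sigma\in Sh(k,l-1)}\epsilon(\sigma)\,L\big(K(x_{\sigma(1)},\dots,x_{\sigma(k)}),x_{\sigma(k+1)},\dots,x_{\sigma(k+l-1)}\big)$$ with $\epsilon(\sigma)$ the Koszul sign ($\iota_KL=0$ if $l=0$), extended to sums of forms. Let $(\rho,[\cdot,\cdot])$ be a Courant structure on $E$, with associated Lie 2-algebra $l_1+l_2+l_3$, such that $\{x\in M:\rho_x\neq0\}$ is dense in $M$. Let $\mathcal N$ be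 a $C^\infty(M)$-multilinear graded symmetric vector valued form of degree $0$ on $V$. By degree reasons $\mathcal N=\lambda+N+\alpha$, where $\lambda\in C^\infty(M)$ acts on $C^\infty(M)$ by multiplication, $N:\Gamma(E)\to\Gamma(E)$ is $C^\infty(M)$-linear, and $\alpha:\Gamma(E)\times\Gamma(E)\to C^\infty(M)$ is $C^\infty(M)$-bilinear and skew-symmetric. Suppose that $[\mathcal N,l_1+l_2+l_3]_{RN}$ is the Lie 2-algebra associated to a Courant structure $(\rho',[\cdot,\cdot]')$ on $E$ with the same scalar product. Then 1. $\lambda$ is a Casimir function, i.e. $\rho(X)\lambda=0$ for all $X\in\Gamma(E)$; 2. $\alpha=0$; 3. $N+N^*=\lambda\,\mathrm{Id}_{\Gamma(E)}$, where $N^*$ is the transpose of $N$ with respect to $\langle\cdot,\cdot\rangle$. Moreover, in this case $[X,Y]'=[X,Y]_N:=[NX,Y]+[X,NY]-N[X,Y]$ and $\rho'(X)=\rho(NX)$ for all $X,Y\in\Gamma(E)$. -/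

import Mathlib

open Bundle
open scoped Manifold ContDiff Bundle

noncomputable section

set_option linter.unusedSectionVars false

namespace CourantLie

section RichardsonNijenhuis

/-! Graded symmetric vector valued forms on a `ℤ`-graded real vector space and their
Richardson-Nijenhuis bracket.  The grading is a family `𝒱 : ℤ → Submodule ℝ V`. -/

variable {V : Type*} [AddCommGroup V] [Module ℝ V]

/-- The Koszul sign `ε(σ)` of a permutation of homogeneous elements `x 0, …, x (n-1)` of degrees
`d 0, …, d (n-1)`, for which `x 0 ⋯ x (n-1) = ε(σ) x (σ 0) ⋯ x (σ (n-1))` in the symmetric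
algebra: each inversion contributes the sign `(-1)^{|x (σ i)| |x (σ j)|}`. -/
def koszulSign {n : ℕ} (d : Fin n → ℤ) (σ : Equiv.Perm (Fin n)) : ℤˣ :=
  ∏ i, ∏ j, if i < j ∧ σ j < σ i then Int.negOnePow (d (σ i) * d (σ j)) else 1

/-- The `(k, n - k)`-shuffles `σ(1) < ⋯ < σ(k)`, `σ(k+1) < ⋯ < σ(n)`. -/
def shuffles (k n : ℕ) : Finset (Equiv.Perm (Fin n)) :=
  Finset.univ.filter fun σ =>
    (∀ i j : Fin n, i < j → (j : ℕ) < k → σ i < σ j) ∧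
    (∀ i j : Fin n, i < j → k ≤ (i : ℕ) → σ i < σ j)

/-- A (formal sum of) graded symmetric vector valued form(s) of degree `e`: for every `n`, an
`n`-linear map `V × ⋯ × V → V` which is graded symmetric and sends homogeneous elements of degrees
`d 0, …, d (n-1)` to a homogeneous element of degree `d 0 + ⋯ + d (n-1) + e`. -/
structure VForm (𝒱 : ℤ → Submodule ℝ V) (e : ℤ) where
  form : ∀ n : ℕ, MultilinearMap ℝ (fun _ : Fin n => V) V
  symm : ∀ (n : ℕ) (d : Fin n → ℤ) (x : Fin n → V), (∀ i, x i ∈ 𝒱 (d i)) →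
    ∀ σ : Equiv.Perm (Fin n), form n x = koszulSign d σ • form n (fun i => x (σ i))
  degree : ∀ (n : ℕ) (d : Fin n → ℤ) (x : Fin n → V), (∀ i, x i ∈ 𝒱 (d i)) →
    form n x ∈ 𝒱 ((∑ i, d i) + e)

/-- The component of arity `n` of the insertion `ι_K L = ∑_{k,l} ι_{K_k} L_l`, evaluated on
homogeneous elements `x i` of degrees `d i`:
`∑_{k + l = n + 1, l ≥ 1} ∑_{σ ∈ Sh(k,l-1)} ε(σ) L_l (K_k (x (σ 1), …, x (σ k)), …, x (σ n))`. -/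
def insertion (K L : ∀ n : ℕ, MultilinearMap ℝ (fun _ : Fin n => V) V)
    (n : ℕ) (d : Fin n → ℤ) (x : Fin n → V) : V :=
  ∑ k : Fin (n + 1), ∑ σ ∈ shuffles k n, koszulSign d σ •
    L (n - k + 1) (Fin.cons
      (K k fun i : Fin k => x (σ (Fin.castLE (Nat.lt_succ_iff.mp k.2) i)))
      (fun j : Fin (n - k) => x (σ ⟨k + j, by omega⟩)))

/-- The component of arity `n` of the Richardson-Nijenhuis bracket
`[K, L] = ι_K L - (-1)^{ab} ι_L K` of forms of degrees `a` and `b`, evaluated on homogeneous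
elements `x i` of degrees `d i`. -/
def rnBracket {𝒱 : ℤ → Submodule ℝ V} {a b : ℤ} (K : VForm 𝒱 a) (L : VForm 𝒱 b)
    (n : ℕ) (d : Fin n → ℤ) (x : Fin n → V) : V :=
  insertion K.form L.form n d x - Int.negOnePow (a * b) • insertion L.form K.form n d x

/-- `P = [K, L]`: a multilinear map is determined by its values on homogeneous elements. -/
def IsRNBracket {𝒱 : ℤ → Submodule ℝ V} {a b c : ℤ} (K : VForm 𝒱 a) (L : VForm 𝒱 b)
    (P : VForm 𝒱 c) : Prop :=
  ∀ (n : ℕ) (d : Fin n → ℤ) (x : Fin n → V), (∀ i, x i ∈ 𝒱 (d i)) →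
    P.form n x = rnBracket K L n d x

end RichardsonNijenhuis

section Bundles

variable (B : Type*) [NormedAddCommGroup B] [NormedSpace ℝ B]
  (M : Type*) [TopologicalSpace M] [ChartedSpace B M]
  (F : Type*) [NormedAddCommGroup F] [NormedSpace ℝ F]
  (E : M → Type*) [TopologicalSpace (TotalSpace F E)]
  [∀ x, TopologicalSpace (E x)] [∀ x, AddCommGroup (E x)] [∀ x, Module ℝ (E x)]
  [FiberBundle F E]

/-- The algebra `C^∞(M)`. -/
abbrev Smooth := C^∞⟮𝓘(ℝ, B), M; 𝓘(ℝ, ℝ), ℝ⟯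

/-- The space `Γ(E)` of smooth sections. -/
abbrev Sec := Cₛ^∞⟮𝓘(ℝ, B); F, E⟯

variable {B M F E}
variable [VectorBundle ℝ F E]

/-- `Γ(E)` as a module over `C^∞(M)`. -/
instance : SMul (Smooth B M) (Sec B M F E) :=
  ⟨fun f X => ⟨fun x => f x • X x, f.contMDiff.smul_section X.contMDiff⟩⟩

@[simp] lemma smooth_smul_apply (f : Smooth B M) (X : Sec B M F E) (x : M) :
    (f • X) x = f x • X x := rfl

instance : Module (Smooth B M) (Sec B M F E) where
  one_smul X := by ext x; simp
  mul_smul f h X := by ext x; simp [mul_smul]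
  smul_zero f := by ext x; simp
  smul_add f X Y := by ext x; simp
  add_smul f h X := by ext x; simp [add_smul]
  zero_smul X := by ext x; simp

variable (B F E)

/-- A smooth non-degenerate symmetric bilinear form on the fibres (of arbitrary signature). -/
structure BundleMetric where
  val : ∀ x : M, E x →L[ℝ] E x →L[ℝ] ℝ
  symm : ∀ (x : M) (v w : E x), val x v w = val x w v
  nondegenerate : ∀ (x : M) (v : E x), (∀ w : E x, val x v w = 0) → v = 0
  contMDiff : ContMDiff 𝓘(ℝ, B) (𝓘(ℝ, B).prod 𝓘(ℝ, F →L[ℝ] F →L[ℝ] ℝ)) ∞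
    (fun x ↦ TotalSpace.mk' (F →L[ℝ] F →L[ℝ] ℝ) x (val x))

/-- A smooth vector bundle map `E → TM` over the identity of `M`. -/
structure Anchor [IsManifold 𝓘(ℝ, B) ∞ M] where
  val : ∀ x : M, E x →L[ℝ] TangentSpace 𝓘(ℝ, B) x
  contMDiff : ContMDiff 𝓘(ℝ, B) (𝓘(ℝ, B).prod 𝓘(ℝ, F →L[ℝ] B)) ∞
    (fun x ↦ TotalSpace.mk' (F →L[ℝ] B) (E := fun x : M => E x →L[ℝ] TangentSpace 𝓘(ℝ, B) x) x
      (val x))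

variable {B F E}

lemma BundleMetric.contMDiffAt_apply (g : BundleMetric B F E) {X Y : ∀ x, E x} {x : M}
    (hX : ContMDiffAt 𝓘(ℝ, B) (𝓘(ℝ, B).prod 𝓘(ℝ, F)) ∞ (fun x => TotalSpace.mk' F x (X x)) x)
    (hY : ContMDiffAt 𝓘(ℝ, B) (𝓘(ℝ, B).prod 𝓘(ℝ, F)) ∞ (fun x => TotalSpace.mk' F x (Y x)) x) :
    ContMDiffAt 𝓘(ℝ, B) 𝓘(ℝ, ℝ) ∞ (fun x => g.val x (X x) (Y x)) x := by
  have : ContMDiffAt 𝓘(ℝ, B) (𝓘(ℝ, B).prod 𝓘(ℝ)) ∞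
      (fun m ↦ TotalSpace.mk' ℝ (E := Bundle.Trivial M ℝ) m (g.val m (X m) (Y m))) x :=
    ContMDiffAt.clm_bundle_apply₂ (F₁ := F) (F₂ := F) g.contMDiff.contMDiffAt hX hY
  simp only [contMDiffAt_totalSpace] at this
  exact this.2

/-- The function `⟨X, Y⟩`. -/
def BundleMetric.pair (g : BundleMetric B F E) (X Y : Sec B M F E) : Smooth B M :=
  ⟨fun x => g.val x (X x) (Y x),
    fun _ => g.contMDiffAt_apply X.contMDiff.contMDiffAt Y.contMDiff.contMDiffAt⟩

variable [IsManifold 𝓘(ℝ, B) ∞ M]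

lemma Anchor.contMDiffAt_apply (ρ : Anchor B F E) (f : Smooth B M) {X : ∀ x, E x} {x : M}
    (hX : ContMDiffAt 𝓘(ℝ, B) (𝓘(ℝ, B).prod 𝓘(ℝ, F)) ∞ (fun x => TotalSpace.mk' F x (X x)) x) :
    ContMDiffAt 𝓘(ℝ, B) 𝓘(ℝ, ℝ) ∞ (fun x => mvfderiv 𝓘(ℝ, B) f x (ρ.val x (X x))) x := by
  have h1 : ContMDiffAt 𝓘(ℝ, B) (𝓘(ℝ, B).prod 𝓘(ℝ, B)) ∞
      (fun m ↦ TotalSpace.mk' B (E := TangentSpace 𝓘(ℝ, B)) m (ρ.val m (X m))) x :=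
    ContMDiffAt.clm_bundle_apply (F₁ := F) (F₂ := B) ρ.contMDiff.contMDiffAt hX
  have h2 := (f.contMDiff.contMDiff_tangentMap (m := ∞) (n := ∞) (by simp)).contMDiffAt.comp x h1
  exact (contMDiff_snd_tangentBundle_modelSpace ℝ 𝓘(ℝ, ℝ)).contMDiffAt.comp x h2

/-- The function `ρ(X) f`, the derivative of `f` along the vector field `ρ(X)`. -/
def Anchor.deriv (ρ : Anchor B F E) (X : Sec B M F E) (f : Smooth B M) : Smooth B M :=
  ⟨fun x => mvfderiv 𝓘(ℝ, B) f x (ρ.val x (X x)),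
    fun _ => ρ.contMDiffAt_apply f X.contMDiff.contMDiffAt⟩


variable [FiniteDimensional ℝ F]

lemma BundleMetric.exists_dual (g : BundleMetric B F E) (x : M) (φ : E x →ₗ[ℝ] ℝ) :
    ∃ v : E x, ∀ w : E x, g.val x v w = φ w := by
  have : FiniteDimensional ℝ (E x) := VectorBundle.finiteDimensional ℝ F E x
  let G : E x →ₗ[ℝ] Module.Dual ℝ (E x) :=
    { toFun := fun v => (g.val x v).toLinearMap
      map_add' := fun v w => by ext; simp
      map_smul' := fun c v => by ext; simp }
  have hinj : Function.Injective G := by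
    rw [injective_iff_map_eq_zero]
    exact fun v hv => g.nondegenerate x v fun w => LinearMap.congr_fun hv w
  have hsurj : Function.Surjective G :=
    (LinearMap.injective_iff_surjective_of_finrank_eq_finrank Subspace.dual_finrank_eq.symm).1 hinj
  obtain ⟨v, hv⟩ := hsurj φ
  exact ⟨v, fun w => LinearMap.congr_fun hv w⟩

/-- The value at `x` of `𝒟 f`: the vector representing `w ↦ d_x f (ρ w)`. -/
def BundleMetric.gradAt (g : BundleMetric B F E) (ρ : Anchor B F E) (f : Smooth B M) (x : M) :
    E x :=
  Classical.choose (g.exists_dual x ((mvfderiv 𝓘(ℝ, B) f x).toLinearMap ∘ₗ (ρ.val x).toLinearMap))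

lemma BundleMetric.gradAt_spec (g : BundleMetric B F E) (ρ : Anchor B F E) (f : Smooth B M)
    (x : M) (w : E x) :
    g.val x (g.gradAt ρ f x) w = mvfderiv 𝓘(ℝ, B) f x (ρ.val x w) :=
  Classical.choose_spec (g.exists_dual x
    ((mvfderiv 𝓘(ℝ, B) f x).toLinearMap ∘ₗ (ρ.val x).toLinearMap)) w

lemma contMDiffAt_det {ι : Type*} [Fintype ι] [DecidableEq ι] {A : M → Matrix ι ι ℝ} {x : M}
    (hA : ∀ i j, ContMDiffAt 𝓘(ℝ, B) 𝓘(ℝ, ℝ) ∞ (fun y => A y i j) x) :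
    ContMDiffAt 𝓘(ℝ, B) 𝓘(ℝ, ℝ) ∞ (fun y => (A y).det) x := by
  simp only [Matrix.det_apply']
  refine contMDiffAt_finsetSum fun σ _ => ?_
  exact contMDiffAt_const.mul (contMDiffAt_finsetProd fun i _ => hA _ _)

variable [ContMDiffVectorBundle ∞ F E 𝓘(ℝ, B)]

lemma BundleMetric.contMDiff_gradAt (g : BundleMetric B F E) (ρ : Anchor B F E)
    (f : Smooth B M) :
    ContMDiff 𝓘(ℝ, B) (𝓘(ℝ, B).prod 𝓘(ℝ, F)) ∞ (fun x => TotalSpace.mk' F x (g.gradAt ρ f x)) := by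
  classical
  intro x
  have : ContMDiffVectorBundle 1 F E 𝓘(ℝ, B) := ContMDiffVectorBundle.of_le (n := ∞) (by simp)
  let e := trivializationAt F E x
  have hx : x ∈ e.baseSet := FiberBundle.mem_baseSet_trivializationAt F E x
  let b := Module.finBasis ℝ F
  let s := e.localFrame b
  have hs : ∀ i, ContMDiffAt 𝓘(ℝ, B) (𝓘(ℝ, B).prod 𝓘(ℝ, F)) ∞
      (fun y => TotalSpace.mk' F y (s i y)) x :=
    fun i => contMDiffAt_localFrame_of_mem ∞ e b i hx
  let A : M → Matrix _ _ ℝ := fun y => Matrix.of fun i j => g.val y (s i y) (s j y)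
  let r : M → _ → ℝ := fun y i => mvfderiv 𝓘(ℝ, B) f y (ρ.val y (s i y))
  have hA : ∀ i j, ContMDiffAt 𝓘(ℝ, B) 𝓘(ℝ, ℝ) ∞ (fun y => A y i j) x :=
    fun i j => g.contMDiffAt_apply (hs i) (hs j)
  have hr : ∀ i, ContMDiffAt 𝓘(ℝ, B) 𝓘(ℝ, ℝ) ∞ (fun y => r y i) x :=
    fun i => ρ.contMDiffAt_apply f (hs i)
  let c := fun (i : Fin (Module.finrank ℝ F)) (y : M) =>
    e.localFrameCoeff 𝓘(ℝ, B) b i y (g.gradAt ρ f y)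
  have hc : ∀ y ∈ e.baseSet, (A y).mulVec (fun i => c i y) = r y := by
    intro y hy
    ext j
    have h1 := e.eq_sum_localFrameCoeff_smul (I := 𝓘(ℝ, B)) (b := b)
      (s := fun y => g.gradAt ρ f y) hy
    have h2 := g.gradAt_spec ρ f y (s j y)
    rw [g.symm, h1, map_sum] at h2
    simp only [map_smul, smul_eq_mul] at h2
    refine Eq.trans ?_ h2
    simp only [Matrix.mulVec, dotProduct]
    exact Finset.sum_congr rfl fun i _ => mul_comm _ _
  have hdet : ∀ y ∈ e.baseSet, (A y).det ≠ 0 := by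
    intro y hy h0
    obtain ⟨v, hv0, hv⟩ := Matrix.exists_mulVec_eq_zero_iff.2 h0
    have hb := (e.isLocalFrameOn_localFrame_baseSet 𝓘(ℝ, B) 1 b)
    apply hv0
    have hz : ∑ i, v i • s i y = 0 := by
      apply g.nondegenerate
      have hz' : (g.val y (∑ i, v i • s i y)).toLinearMap = 0 := by
        refine (e.basisAt b hy).ext fun j => ?_
        rw [← e.localFrame_apply_of_mem_baseSet b hy]
        have := congrFun hv j
        simp only [Matrix.mulVec, dotProduct, Pi.zero_apply] at this
        rw [ContinuousLinearMap.coe_coe, g.symm, map_sum]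
        simp only [map_smul, smul_eq_mul, LinearMap.zero_apply]
        rw [← this]
        exact Finset.sum_congr rfl fun i _ => mul_comm _ _
      exact fun w => LinearMap.congr_fun hz' w
    funext i
    exact Fintype.linearIndependent_iff.1 (hb.linearIndependent hy) v hz i
  rw [contMDiffAt_iff_localFrameCoeff b hx]
  intro i
  have hcr : ∀ y ∈ e.baseSet, c i y = (A y).det⁻¹ * ((A y).updateCol i (r y)).det := by
    intro y hy
    have hu : IsUnit (A y).det := (hdet y hy).isUnit
    have h1 : (A y).mulVec ((A y).det • fun i => c i y) = (A y).mulVec ((A y).cramer (r y)) := by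
      rw [Matrix.mulVec_cramer, Matrix.mulVec_smul, hc y hy]
    have h2 := congrFun (Matrix.mulVec_injective_of_isUnit
      ((Matrix.isUnit_iff_isUnit_det _).2 hu) h1) i
    rw [Matrix.cramer_apply] at h2
    rw [← h2]
    simp [hdet y hy]
  have hsm : ContMDiffAt 𝓘(ℝ, B) 𝓘(ℝ, ℝ) ∞
      (fun y => (A y).det⁻¹ * ((A y).updateCol i (r y)).det) x := by
    refine ((contMDiffAt_det hA).inv₀ (hdet x hx)).mul (contMDiffAt_det fun j k => ?_)
    by_cases hk : k = i
    · subst hk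
      simpa using hr j
    · simpa [Matrix.updateCol_ne hk] using hA j k
  refine hsm.congr_of_eventuallyEq ?_
  filter_upwards [e.open_baseSet.mem_nhds hx] with y hy
  exact hcr y hy

/-- The operator `𝒟 : C^∞(M) → Γ(E)` determined by `⟨𝒟 f, X⟩ = ρ(X) f`. -/
def BundleMetric.grad (g : BundleMetric B F E) (ρ : Anchor B F E) (f : Smooth B M) : Sec B M F E :=
  ⟨g.gradAt ρ f, g.contMDiff_gradAt ρ f⟩

lemma BundleMetric.pair_grad (g : BundleMetric B F E) (ρ : Anchor B F E) (f : Smooth B M)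
    (X : Sec B M F E) : g.pair (g.grad ρ f) X = ρ.deriv X f := by
  ext x
  exact g.gradAt_spec ρ f x (X x)

/-- The function `T(X, Y, Z) = 1/6 ⟨[X, Y], Z⟩ + c.p.` -/
def BundleMetric.T (g : BundleMetric B F E)
    (br : Sec B M F E →ₗ[ℝ] Sec B M F E →ₗ[ℝ] Sec B M F E) (X Y Z : Sec B M F E) : Smooth B M :=
  (1 / 6 : ℝ) • (g.pair (br X Y) Z + g.pair (br Y Z) X + g.pair (br Z X) Y)

/-- A Courant structure `(ρ, [·,·], ⟨·,·⟩)` on the vector bundle `E → M` with the scalar product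
`⟨·,·⟩ = g`, in terms of the skew-symmetric bracket. -/
structure CourantStructure (g : BundleMetric B F E) where
  anchor : Anchor B F E
  bracket : Sec B M F E →ₗ[ℝ] Sec B M F E →ₗ[ℝ] Sec B M F E
  skew : ∀ X Y, bracket X Y = -bracket Y X
  jacobi : ∀ X Y Z,
    bracket (bracket X Y) Z + bracket (bracket Y Z) X + bracket (bracket Z X) Y =
      g.grad anchor (g.T bracket X Y Z)
  anchor_bracket : ∀ (X Y : Sec B M F E) (x : M),
    anchor.val x (bracket X Y x) = VectorField.mlieBracket 𝓘(ℝ, B)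
      (fun y => anchor.val y (X y)) (fun y => anchor.val y (Y y)) x
  leibniz : ∀ (X Y : Sec B M F E) (f : Smooth B M),
    bracket X (f • Y) = f • bracket X Y + anchor.deriv X f • Y -
      (1 / 2 : ℝ) • (g.pair X Y • g.grad anchor f)
  anchor_grad : ∀ (f : Smooth B M) (x : M), anchor.val x (g.grad anchor f x) = 0
  invariance : ∀ X Y₁ Y₂ : Sec B M F E,
    anchor.deriv X (g.pair Y₁ Y₂) =
      g.pair (bracket X Y₁ + (1 / 2 : ℝ) • g.grad anchor (g.pair X Y₁)) Y₂ +
      g.pair Y₁ (bracket X Y₂ + (1 / 2 : ℝ) • g.grad anchor (g.pair X Y₂))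

namespace CourantStructure

variable {g : BundleMetric B F E} (C : CourantStructure g)

/-- The operator `𝒟` of a Courant structure. -/
def D (f : Smooth B M) : Sec B M F E := g.grad C.anchor f

/-- `λ` is a Casimir function: `ρ(X) λ = 0` for all sections `X`. -/
def IsCasimir (f : Smooth B M) : Prop := ∀ X : Sec B M F E, C.anchor.deriv X f = 0

/-- The deformed bracket `[X, Y]_N = [N X, Y] + [X, N Y] - N [X, Y]`. -/
def deformedBracket (N : Sec B M F E → Sec B M F E) (X Y : Sec B M F E) : Sec B M F E :=
  C.bracket (N X) Y + C.bracket X (N Y) - N (C.bracket X Y)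

end CourantStructure

variable (B M F E) in
/-- The graded vector space `C^∞(M) ⊕ Γ(E)`, with `C^∞(M)` in degree `-2`, `Γ(E)` in degree `-1`. -/
def grading (d : ℤ) : Submodule ℝ (Smooth B M × Sec B M F E) :=
  if d = -2 then Submodule.prod ⊤ ⊥ else if d = -1 then Submodule.prod ⊥ ⊤ else ⊥

lemma mem_grading {d : ℤ} {v : Smooth B M × Sec B M F E} (hv : v ∈ grading B M F E d) :
    (d = -2 ∧ v.2 = 0) ∨ (d = -1 ∧ v.1 = 0) ∨ v = 0 := by
  unfold grading at hv
  split_ifs at hv with h1 h2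
  · exact Or.inl ⟨h1, by simpa [Submodule.mem_prod] using hv⟩
  · exact Or.inr (Or.inl ⟨h2, by simpa [Submodule.mem_prod] using hv⟩)
  · exact Or.inr (Or.inr (by simpa using hv))

lemma snd_eq_zero_or {d : ℤ} {v : Smooth B M × Sec B M F E} (hv : v ∈ grading B M F E d) :
    v.2 = 0 ∨ d = -1 := by
  rcases mem_grading hv with h | h | h
  · exact Or.inl h.2
  · exact Or.inr h.1
  · exact Or.inl (by simp [h])

lemma mem_grading_neg_two {v : Smooth B M × Sec B M F E} (hv : v.2 = 0) :
    v ∈ grading B M F E (-2) := by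
  simp [grading, Submodule.mem_prod, hv]

lemma mem_grading_neg_one {v : Smooth B M × Sec B M F E} (hv : v.1 = 0) :
    v ∈ grading B M F E (-1) := by
  simp [grading, Submodule.mem_prod, hv]

namespace BundleMetric

variable (g : BundleMetric B F E)

lemma pair_ext {X Y : Sec B M F E} (h : ∀ (x : M) (w : E x), g.val x (X x) w = g.val x (Y x) w) :
    X = Y := by
  ext x
  rw [← sub_eq_zero]
  exact g.nondegenerate x _ fun w => by rw [map_sub, sub_apply, h, sub_self]

lemma pair_comm (X Y : Sec B M F E) : g.pair X Y = g.pair Y X := by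
  ext x; exact g.symm x _ _

lemma pair_add_left (X Y Z : Sec B M F E) : g.pair (X + Y) Z = g.pair X Z + g.pair Y Z := by
  ext x; simp [pair]; rfl

lemma pair_smul_left (c : ℝ) (X Z : Sec B M F E) : g.pair (c • X) Z = c • g.pair X Z := by
  ext x; simp [pair]; rfl

lemma pair_add_right (X Y Z : Sec B M F E) : g.pair Z (X + Y) = g.pair Z X + g.pair Z Y := by
  ext x; simp [pair]; rfl

lemma pair_smul_right (c : ℝ) (X Z : Sec B M F E) : g.pair Z (c • X) = c • g.pair Z X := by
  ext x; simp [pair]; rfl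

lemma grad_add (ρ : Anchor B F E) (f h : Smooth B M) :
    g.grad ρ (f + h) = g.grad ρ f + g.grad ρ h := by
  refine g.pair_ext fun x w => ?_
  have hf := f.contMDiff.mdifferentiable (by simp) x
  have hh := h.contMDiff.mdifferentiable (by simp) x
  simp [grad, gradAt_spec, mvfderiv_add hf hh]

lemma grad_smul (ρ : Anchor B F E) (c : ℝ) (f : Smooth B M) :
    g.grad ρ (c • f) = c • g.grad ρ f := by
  refine g.pair_ext fun x w => ?_
  have hf := f.contMDiff.mdifferentiable (by simp) x
  have h := mvfderiv_smul (x := x) (a := fun _ : M => c) mdifferentiableAt_const hf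
  have h' : (⇑(c • f) : M → ℝ) = (fun _ : M => c) • ⇑f := by ext; simp
  simp only [grad, ContMDiffSection.coeFn_mk, gradAt_spec, h', h, ContMDiffSection.coe_smul,
    Pi.smul_apply, map_smul]
  simp [mvfderiv_const, gradAt_spec]

end BundleMetric

namespace CourantStructure

variable {g : BundleMetric B F E} (C : CourantStructure g)

/-- `l₁ f = 𝒟 f`, extended by zero on `Γ(E)`. -/
def l₁ : MultilinearMap ℝ (fun _ : Fin 1 => Smooth B M × Sec B M F E)
    (Smooth B M × Sec B M F E) where
  toFun v := (0, C.D (v 0).1)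
  map_update_add' v i x y := by
    fin_cases i
    simp [D, g.grad_add]
  map_update_smul' v i c x := by
    fin_cases i
    simp [D, g.grad_smul]

/-- `l₂(X, Y) = [X, Y]` on `Γ(E)`, `l₂(X, f) = l₂(f, X) = 1/2 ⟨X, 𝒟 f⟩`, and zero on functions. -/
def l₂ : MultilinearMap ℝ (fun _ : Fin 2 => Smooth B M × Sec B M F E)
    (Smooth B M × Sec B M F E) where
  toFun v := ((1 / 2 : ℝ) • (g.pair (v 0).2 (C.D (v 1).1) + g.pair (v 1).2 (C.D (v 0).1)),
    C.bracket (v 0).2 (v 1).2)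
  map_update_add' v i x y := by
    fin_cases i <;>
      simp [D, g.grad_add, BundleMetric.pair_add_left, BundleMetric.pair_add_right] <;>
      module
  map_update_smul' v i c x := by
    fin_cases i <;>
      simp [D, g.grad_smul, BundleMetric.pair_smul_left, BundleMetric.pair_smul_right] <;>
      module

/-- `l₃(X, Y, Z) = T(X, Y, Z)`, extended by zero. -/
def l₃ : MultilinearMap ℝ (fun _ : Fin 3 => Smooth B M × Sec B M F E)
    (Smooth B M × Sec B M F E) where
  toFun v := (g.T C.bracket (v 0).2 (v 1).2 (v 2).2, 0)
  map_update_add' v i x y := by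
    have hi : i = 0 ∨ i = 1 ∨ i = 2 := by omega
    have h01 : (0 : Fin 3) ≠ 1 := by omega
    have h02 : (0 : Fin 3) ≠ 2 := by omega
    have h12 : (1 : Fin 3) ≠ 2 := by omega
    rcases hi with rfl | rfl | rfl <;>
      simp only [Function.update_self, Function.update_of_ne h01, Function.update_of_ne h01.symm,
        Function.update_of_ne h02, Function.update_of_ne h02.symm, Function.update_of_ne h12,
        Function.update_of_ne h12.symm] <;>
      simp [BundleMetric.T, BundleMetric.pair_add_left, BundleMetric.pair_add_right] <;>
      module
  map_update_smul' v i c x := by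
    have hi : i = 0 ∨ i = 1 ∨ i = 2 := by omega
    have h01 : (0 : Fin 3) ≠ 1 := by omega
    have h02 : (0 : Fin 3) ≠ 2 := by omega
    have h12 : (1 : Fin 3) ≠ 2 := by omega
    rcases hi with rfl | rfl | rfl <;>
      simp only [Function.update_self, Function.update_of_ne h01, Function.update_of_ne h01.symm,
        Function.update_of_ne h02, Function.update_of_ne h02.symm, Function.update_of_ne h12,
        Function.update_of_ne h12.symm] <;>
      simp [BundleMetric.T, BundleMetric.pair_smul_left, BundleMetric.pair_smul_right] <;>
      module

/-- The components of `l₁ + l₂ + l₃`. -/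
def lieTwoForm : ∀ n : ℕ, MultilinearMap ℝ (fun _ : Fin n => Smooth B M × Sec B M F E)
    (Smooth B M × Sec B M F E)
  | 1 => C.l₁
  | 2 => C.l₂
  | 3 => C.l₃
  | _ => 0


lemma lieTwoForm_eq_zero {n : ℕ} (h : n ≠ 1 ∧ n ≠ 2 ∧ n ≠ 3) : C.lieTwoForm n = 0 := by
  match n, h with
  | 0, _ => rfl
  | n + 4, _ => rfl

lemma grad_zero (ρ : Anchor B F E) : g.grad ρ 0 = 0 := by
  simpa using g.grad_smul ρ 0 0

lemma pair_zero_left (X : Sec B M F E) : g.pair 0 X = 0 := by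
  simpa using g.pair_smul_left 0 0 X

lemma pair_zero_right (X : Sec B M F E) : g.pair X 0 = 0 := by
  simpa using g.pair_smul_right 0 0 X

lemma negOnePow_two : Int.negOnePow 2 = 1 := rfl

lemma T_eq_zero {X Y Z : Sec B M F E} (h : X = 0 ∨ Y = 0 ∨ Z = 0) : g.T C.bracket X Y Z = 0 := by
  rcases h with rfl | rfl | rfl <;> simp [BundleMetric.T, pair_zero_left, pair_zero_right]

lemma T_rotate (X Y Z : Sec B M F E) : g.T C.bracket Y Z X = g.T C.bracket X Y Z := by
  simp only [BundleMetric.T]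
  module

lemma T_swap (X Y Z : Sec B M F E) : g.T C.bracket Y X Z = -g.T C.bracket X Y Z := by
  have h : ∀ U W : Sec B M F E, g.pair (-U) W = -g.pair U W := fun U W => by
    simpa using g.pair_smul_left (-1) U W
  simp only [BundleMetric.T]
  rw [C.skew Y X, C.skew X Z, C.skew Z Y, h, h, h]
  module

/-- The form `l₁ + l₂ + l₃` on `C^∞(M) ⊕ Γ(E)` associated with a Courant structure. -/
def lieTwo : VForm (grading B M F E) 1 where
  form := C.lieTwoForm
  symm n d x hx σ := by
    match n, d, x, hx, σ with
    | 0, d, x, hx, σ => simp [lieTwoForm]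
    | 1, d, x, hx, σ =>
      obtain rfl : σ = 1 := Subsingleton.elim _ _
      simp [koszulSign]
    | 2, d, x, hx, σ =>
      have hσ : (σ 0 = 0 ∧ σ 1 = 1) ∨ (σ 0 = 1 ∧ σ 1 = 0) := by
        revert σ; decide
      rcases hσ with ⟨h0, h1⟩ | ⟨h0, h1⟩
      · simp [koszulSign, h0, h1, lieTwoForm, l₂]
      · rcases mem_grading (hx 0) with ⟨e0, z0⟩ | ⟨e0, z0⟩ | z0
        · rcases mem_grading (hx 1) with ⟨e1, z1⟩ | ⟨e1, z1⟩ | z1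
          · simp [koszulSign, h0, h1, lieTwoForm, l₂, z0, z1, pair_zero_left]
          · simp [koszulSign, h0, h1, lieTwoForm, l₂, z0, e0, e1, pair_zero_left, negOnePow_two]
          · simp [koszulSign, h0, h1, lieTwoForm, l₂, z0, z1, pair_zero_left]
        · rcases mem_grading (hx 1) with ⟨e1, z1⟩ | ⟨e1, z1⟩ | z1
          · simp [koszulSign, h0, h1, lieTwoForm, l₂, z1, e0, e1, pair_zero_left, negOnePow_two]
          · simp [koszulSign, h0, h1, lieTwoForm, l₂, z0, z1, D, grad_zero, pair_zero_right,
              Units.smul_def, e0, e1]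
            exact C.skew _ _
          · simp [koszulSign, h0, h1, lieTwoForm, l₂, z1, D, grad_zero, pair_zero_left,
              pair_zero_right]
        · simp [koszulSign, h0, h1, lieTwoForm, l₂, z0, D, grad_zero, pair_zero_left,
            pair_zero_right]
    | 3, d, x, hx, σ =>
      have hσ : (σ 0 = 0 ∧ σ 1 = 1 ∧ σ 2 = 2) ∨ (σ 0 = 1 ∧ σ 1 = 0 ∧ σ 2 = 2) ∨
          (σ 0 = 0 ∧ σ 1 = 2 ∧ σ 2 = 1) ∨ (σ 0 = 2 ∧ σ 1 = 1 ∧ σ 2 = 0) ∨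
          (σ 0 = 1 ∧ σ 1 = 2 ∧ σ 2 = 0) ∨ (σ 0 = 2 ∧ σ 1 = 0 ∧ σ 2 = 1) := by
        revert σ; decide
      simp only [lieTwoForm, l₃, MultilinearMap.coe_mk]
      by_cases hz : (x 0).2 = 0 ∨ (x 1).2 = 0 ∨ (x 2).2 = 0
      · have hz' : (x (σ 0)).2 = 0 ∨ (x (σ 1)).2 = 0 ∨ (x (σ 2)).2 = 0 := by
          rcases hσ with ⟨h0, h1, h2⟩ | ⟨h0, h1, h2⟩ | ⟨h0, h1, h2⟩ | ⟨h0, h1, h2⟩ |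
            ⟨h0, h1, h2⟩ | ⟨h0, h1, h2⟩ <;> rw [h0, h1, h2] <;> tauto
        rw [C.T_eq_zero hz, C.T_eq_zero hz']
        exact (smul_zero _).symm
      · have e0 := (snd_eq_zero_or (hx 0)).resolve_left (by tauto)
        have e1 := (snd_eq_zero_or (hx 1)).resolve_left (by tauto)
        have e2 := (snd_eq_zero_or (hx 2)).resolve_left (by tauto)
        have hd : d = fun _ => -1 := by
          funext i
          have hi : i = 0 ∨ i = 1 ∨ i = 2 := by omega
          rcases hi with rfl | rfl | rfl <;> assumption
        subst hd
        rcases hσ with ⟨h0, h1, h2⟩ | ⟨h0, h1, h2⟩ | ⟨h0, h1, h2⟩ | ⟨h0, h1, h2⟩ |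
            ⟨h0, h1, h2⟩ | ⟨h0, h1, h2⟩ <;>
          simp [koszulSign, Fin.prod_univ_three, h0, h1, h2, Units.smul_def]
        · rw [C.T_swap (x 0).2, neg_neg]
        · rw [C.T_rotate (x 2).2, C.T_swap (x 0).2]
        · rw [C.T_swap (x 1).2, C.T_rotate (x 2).2]
        · rw [C.T_rotate (x 0).2]
        · rw [C.T_rotate (x 2).2]
    | n + 4, d, x, hx, σ => simp [lieTwoForm]
  degree n d x hx := by
    match n, d, x, hx with
    | 0, d, x, hx => simp [lieTwoForm]
    | 1, d, x, hx =>
      rcases mem_grading (hx 0) with ⟨e0, z0⟩ | ⟨e0, z0⟩ | z0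
      · simp [e0]
        exact mem_grading_neg_one rfl
      · have : C.l₁ x = 0 := by simp [l₁, z0, D, grad_zero]
        simp [lieTwoForm, this]
      · have : C.l₁ x = 0 := by simp [l₁, z0, D, grad_zero]
        simp [lieTwoForm, this]
    | 2, d, x, hx =>
      change C.l₂ x ∈ _
      rcases mem_grading (hx 0) with ⟨e0, z0⟩ | ⟨e0, z0⟩ | z0
      · rcases mem_grading (hx 1) with ⟨e1, z1⟩ | ⟨e1, z1⟩ | z1
        · have : C.l₂ x = 0 := by simp [l₂, z0, z1, pair_zero_left]
          simp [this]
        · simp only [Fin.sum_univ_two, e0, e1]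
          exact mem_grading_neg_two (by simp [l₂, z0])
        · have : C.l₂ x = 0 := by simp [l₂, z0, z1, pair_zero_left]
          simp [this]
      · rcases mem_grading (hx 1) with ⟨e1, z1⟩ | ⟨e1, z1⟩ | z1
        · simp only [Fin.sum_univ_two, e0, e1]
          exact mem_grading_neg_two (by simp [l₂, z1])
        · simp only [Fin.sum_univ_two, e0, e1]
          exact mem_grading_neg_one (by simp [l₂, z0, z1, D, grad_zero, pair_zero_right])
        · have : C.l₂ x = 0 := by simp [l₂, z1, D, grad_zero, pair_zero_left, pair_zero_right]
          simp [this]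
      · have : C.l₂ x = 0 := by simp [l₂, z0, D, grad_zero, pair_zero_left, pair_zero_right]
        simp [this]
    | 3, d, x, hx =>
      change C.l₃ x ∈ _
      by_cases hz : (x 0).2 = 0 ∨ (x 1).2 = 0 ∨ (x 2).2 = 0
      · have : C.l₃ x = 0 := by simp [l₃, C.T_eq_zero hz]
        simp [this]
      · have e0 := (snd_eq_zero_or (hx 0)).resolve_left (by tauto)
        have e1 := (snd_eq_zero_or (hx 1)).resolve_left (by tauto)
        have e2 := (snd_eq_zero_or (hx 2)).resolve_left (by tauto)
        simp only [Fin.sum_univ_three, e0, e1, e2]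
        exact mem_grading_neg_two rfl
    | n + 4, d, x, hx => simp [lieTwoForm]

end CourantStructure

section LinearForms

variable {e : ℤ}

/-- The form is `C^∞(M)`-linear in each argument. -/
def IsSmoothLinear (K : VForm (grading B M F E) e) : Prop :=
  ∀ (n : ℕ) (x : Fin n → Smooth B M × Sec B M F E) (i : Fin n) (f : Smooth B M)
    (v : Smooth B M × Sec B M F E),
    K.form n (Function.update x i (f • v)) = f • K.form n (Function.update x i v)

/-- The function `λ` such that a `C^∞(M)`-linear form of degree `0` restricts to `f ↦ λ f` on
`C^∞(M)`. -/
def functionPart (K : VForm (grading B M F E) 0) : Smooth B M :=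
  (K.form 1 ![(1, 0)]).1

/-- The restriction `N : Γ(E) → Γ(E)` of the `1`-form component of a form of degree `0`. -/
def tensorPart (K : VForm (grading B M F E) 0) (X : Sec B M F E) : Sec B M F E :=
  (K.form 1 ![(0, X)]).2

/-- The restriction `α : Γ(E) × Γ(E) → C^∞(M)` of the `2`-form component of a form of degree
`0`. -/
def twoFormPart (K : VForm (grading B M F E) 0) (X Y : Sec B M F E) : Smooth B M :=
  (K.form 2 ![(0, X), (0, Y)]).1

lemma snd_eq_zero {v : Smooth B M × Sec B M F E} {d : ℤ} (hv : v ∈ grading B M F E d)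
    (hd : d ≠ -1) : v.2 = 0 := (snd_eq_zero_or hv).resolve_right hd

lemma fst_eq_zero {v : Smooth B M × Sec B M F E} {d : ℤ} (hv : v ∈ grading B M F E d)
    (hd : d ≠ -2) : v.1 = 0 := by
  rcases mem_grading hv with h | h | h
  · exact absurd h.1 hd
  · exact h.2
  · simp [h]

lemma update_one {W : Type*} (a b : W) : Function.update ![a] 0 b = ![b] := by
  ext i; fin_cases i; rfl

/-- A `C^∞(M)`-linear form of degree `0` is the sum `λ + N + α`: its component of arity one. -/
lemma form_one (K : VForm (grading B M F E) 0) (hK : IsSmoothLinear K) (f : Smooth B M)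
    (X : Sec B M F E) : K.form 1 ![(f, X)] = (functionPart K * f, tensorPart K X) := by
  have hadd : K.form 1 ![(f, X)] = K.form 1 ![(f, 0)] + K.form 1 ![(0, X)] := by
    have := (K.form 1).map_update_add ![(0, 0)] 0 (f, 0) (0, X)
    simpa only [update_one, Prod.mk_add_mk, add_zero, zero_add] using this
  have hf : K.form 1 ![(f, 0)] = f • K.form 1 ![(1, 0)] := by
    have := hK 1 ![(0, 0)] 0 f (1, 0)
    simpa only [update_one, Prod.smul_mk, smul_eq_mul, mul_one, smul_zero] using this
  have h1 := K.degree 1 (fun _ => -2) ![(1, 0)] (fun i => by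
    fin_cases i; exact mem_grading_neg_two rfl)
  have h2 := K.degree 1 (fun _ => -1) ![(0, X)] (fun i => by
    fin_cases i; exact mem_grading_neg_one rfl)
  have h1' := snd_eq_zero h1 (by simp)
  have h2' := fst_eq_zero h2 (by simp)
  rw [hadd, hf]
  refine Prod.ext ?_ ?_
  · simp [h2', functionPart, mul_comm]
  · simp [h1', tensorPart]

/-- A form of degree `0` is the sum `λ + N + α`: its component of arity two. -/
lemma form_two (K : VForm (grading B M F E) 0) (f h : Smooth B M)
    (X Y : Sec B M F E) : K.form 2 ![(f, X), (h, Y)] = (twoFormPart K X Y, 0) := by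
  have key : ∀ (d : Fin 2 → ℤ) (x : Fin 2 → Smooth B M × Sec B M F E),
      (∀ i, x i ∈ grading B M F E (d i)) → d 0 + d 1 ≤ -3 → K.form 2 x = 0 := by
    intro d x hx hd
    have := K.degree 2 d x hx
    rw [Fin.sum_univ_two] at this
    exact Prod.ext (fst_eq_zero this (by omega)) (snd_eq_zero this (by omega))
  have u0 : ∀ a b c : Smooth B M × Sec B M F E, Function.update ![a, b] 0 c = ![c, b] := by
    intro a b c; ext i <;> fin_cases i <;> rfl
  have u1 : ∀ a b c : Smooth B M × Sec B M F E, Function.update ![a, b] 1 c = ![a, c] := by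
    intro a b c; ext i <;> fin_cases i <;> rfl
  have a0 : ∀ a b c : Smooth B M × Sec B M F E,
      K.form 2 ![a + b, c] = K.form 2 ![a, c] + K.form 2 ![b, c] := by
    intro a b c
    simpa only [u0] using (K.form 2).map_update_add ![0, c] 0 a b
  have a1 : ∀ a b c : Smooth B M × Sec B M F E,
      K.form 2 ![c, a + b] = K.form 2 ![c, a] + K.form 2 ![c, b] := by
    intro a b c
    simpa only [u1] using (K.form 2).map_update_add ![c, 0] 1 a b
  have s0 : ∀ (k : Smooth B M) (Z : Sec B M F E), (k, Z) = (k, 0) + (0, Z) := by simp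
  have z1 : K.form 2 ![(f, 0), (h, 0)] = 0 := key (fun _ => -2) _ (fun i => by
    fin_cases i <;> exact mem_grading_neg_two rfl) (by simp)
  have z2 : K.form 2 ![(f, 0), (0, Y)] = 0 := key ![-2, -1] _ (fun i => by
    fin_cases i
    · exact mem_grading_neg_two rfl
    · exact mem_grading_neg_one rfl) (by simp)
  have z3 : K.form 2 ![(0, X), (h, 0)] = 0 := key ![-1, -2] _ (fun i => by
    fin_cases i
    · exact mem_grading_neg_one rfl
    · exact mem_grading_neg_two rfl) (by simp)
  have h4 := snd_eq_zero (K.degree 2 (fun _ => -1) ![(0, X), (0, Y)] (fun i => by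
    fin_cases i <;> exact mem_grading_neg_one rfl)) (by simp)
  rw [s0 f X, s0 h Y, a0, a1, a1, z1, z2, z3]
  exact Prod.ext (by simp [twoFormPart]) (by simpa using h4)

/-- A form of degree `0` is the sum `λ + N + α`: it has no further components. -/
lemma form_eq_zero (K : VForm (grading B M F E) 0) {n : ℕ} (h1 : n ≠ 1) (h2 : n ≠ 2) :
    K.form n = 0 := by
  ext1 x
  have hx : x = (fun i => ((x i).1, 0)) + fun i => (0, (x i).2) := by
    funext i; simp
  rw [hx, MultilinearMap.map_add_univ]
  refine Finset.sum_eq_zero fun s _ => ?_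
  have hd := K.degree n (fun i => if i ∈ s then -2 else -1)
    (s.piecewise (fun i => ((x i).1, 0)) fun i => (0, (x i).2)) (fun i => by
      by_cases hi : i ∈ s
      · simp [hi, mem_grading_neg_two]
      · simp [hi, mem_grading_neg_one])
  have hle : ∑ i : Fin n, (if i ∈ s then (-2 : ℤ) else -1) ≤ -n := by
    calc _ ≤ ∑ i : Fin n, (-1 : ℤ) := Finset.sum_le_sum fun i _ => by split_ifs <;> simp
      _ = -n := by simp
  have hne : (∑ i : Fin n, (if i ∈ s then (-2 : ℤ) else -1)) + 0 ≠ -1 ∧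
      (∑ i : Fin n, (if i ∈ s then (-2 : ℤ) else -1)) + 0 ≠ -2 := by
    rcases Nat.eq_zero_or_pos n with rfl | hn
    · simp
    · omega
  exact Prod.ext (fst_eq_zero hd hne.2) (snd_eq_zero hd hne.1)

end LinearForms

end Bundles

end CourantLie

end

set_option linter.unusedSectionVars false

/-! Write `λ`, `N`, `α` for the components of `𝒩`, and `D`, `D'` for the two operators `𝒟`. Two
components of the equation `[𝒩, l₁ + l₂ + l₃] = l₁' + l₂' + l₃'` suffice. On functions it reads `D'
f = D (λ f) - N (D f)`; at `f = 1` this gives `D λ = 0`, so `λ` is Casimir and `D' f = λ D f - N (D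
f)`. On pairs of sections it reads `[X, Y]' = [X, Y]_N + D α(X, Y)`.

Let `S(X, Y) = ⟨N X, Y⟩ + ⟨X, N Y⟩ - λ ⟨X, Y⟩`. Comparing the Leibniz rules of both structures
yields the pointwise identity `S(X, D f) Y = (½ S(X, Y) - α(X, Y)) D f` (`symmetricDefect_smul_eq`).
Where `ρ_x ≠ 0`, take `Z` and `f` with `(ρ(Z) f)(x) ≠ 0`. Putting `Y = Z` and applying `ρ`, which
kills `D f`, gives `S(X, D f) = 0` at `x`; since `D f` does not vanish there, `½ S = α` at `x`
(`symmetricDefect_apply`).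

By density `½ S = α` on all of `M`. As `S` is symmetric and `α` is skew, both vanish. This is `α =
0` and `N + N* = λ Id`; the formulas for the bracket and the anchor follow. -/

namespace CourantLie

/-! ### Insertions in arities one and two. -/

section RichardsonNijenhuis

variable {V : Type*} [AddCommGroup V] [Module ℝ V]

lemma koszulSign_one {n : ℕ} (d : Fin n → ℤ) : koszulSign d 1 = 1 := by
  refine Finset.prod_eq_one fun i _ => Finset.prod_eq_one fun j _ => ?_
  rw [if_neg]
  rintro ⟨h, h'⟩
  exact lt_asymm h h'

lemma insertion_one {K L : ∀ n : ℕ, MultilinearMap ℝ (fun _ : Fin n => V) V} (hK : K 0 = 0)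
    (d : Fin 1 → ℤ) (x : V) :
    insertion K L 1 d ![x] = L 1 ![K 1 ![x]] := by
  have h : shuffles 1 1 = {1} := by decide
  rw [insertion, Fin.sum_univ_two]
  -- The sum over `k` starts at `k = 0`, where the constant `K 0` is inserted into `L`; `hK` removes
  -- this term.
  have h0 : ∀ (y : Fin 0 → V) (z : Fin 1 → V), L 2 (Fin.cons (K 0 y) z) = 0 := fun y z =>
    (L 2).map_coord_zero 0 (by simp [hK])
  refine (congrArg (· + _) (Finset.sum_eq_zero fun σ _ => ?_)).trans ((zero_add _).trans ?_)
  · exact (congrArg _ (h0 _ _)).trans (smul_zero _)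
  · change ∑ σ ∈ shuffles 1 1, _ = _
    rw [h, Finset.sum_singleton, koszulSign_one, one_smul]
    exact congrArg (L 1) (by ext i; fin_cases i; exact congrArg (K 1) (by ext i; fin_cases i; rfl))

lemma insertion_two {K L : ∀ n : ℕ, MultilinearMap ℝ (fun _ : Fin n => V) V} (hK : K 0 = 0)
    (d : Fin 2 → ℤ) (x y : V) :
    insertion K L 2 d ![x, y] = L 2 ![K 1 ![x], y] + Int.negOnePow (d 1 * d 0) • L 2 ![K 1 ![y], x]
      + L 1 ![K 2 ![x, y]] := by
  -- Both permutations are (1,1)-shuffles, whence the two terms in `L 2`; only the swap carries a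
  -- Koszul sign.
  have h1 : shuffles 1 2 = {1, Equiv.swap 0 1} := by decide
  have h2 : shuffles 2 2 = {1} := by decide
  have hs : koszulSign d (Equiv.swap 0 1) = Int.negOnePow (d 1 * d 0) := by
    simp [koszulSign]
  have hne : (1 : Equiv.Perm (Fin 2)) ≠ Equiv.swap 0 1 := by decide
  have h0 : ∀ (y : Fin 0 → V) (z : Fin 2 → V), L 3 (Fin.cons (K 0 y) z) = 0 := fun y z =>
    (L 3).map_coord_zero 0 (by simp [hK])
  rw [insertion, Fin.sum_univ_three]
  refine congrArg₂ (· + ·) ((congrArg (· + _) (Finset.sum_eq_zero fun σ _ => ?_)).trans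
    ((zero_add _).trans ?_)) ?_
  · exact (congrArg _ (h0 _ _)).trans (smul_zero _)
  · change ∑ σ ∈ shuffles 1 2, _ = _
    rw [h1, Finset.sum_pair hne, koszulSign_one, one_smul, hs]
    refine congrArg₂ (· + ·) (congrArg (L 2) ?_) (congrArg _ (congrArg (L 2) ?_))
    · ext i; fin_cases i
      · exact congrArg (K 1) (by ext i; fin_cases i; rfl)
      · rfl
    · ext i; fin_cases i
      · exact congrArg (K 1) (by ext i; fin_cases i; rfl)
      · rfl
  · change ∑ σ ∈ shuffles 2 2, _ = _
    rw [h2, Finset.sum_singleton, koszulSign_one, one_smul]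
    exact congrArg (L 1) (by ext i; fin_cases i; exact congrArg (K 2) (by ext i; fin_cases i <;> rfl))

end RichardsonNijenhuis

/-! ### Global functions and sections with prescribed behaviour at a point. -/

section Extension

variable {B : Type*} [NormedAddCommGroup B] [NormedSpace ℝ B] [FiniteDimensional ℝ B]
  {M : Type*} [TopologicalSpace M] [T2Space M] [ChartedSpace B M] [IsManifold 𝓘(ℝ, B) ∞ M]
  {F : Type*} [NormedAddCommGroup F] [NormedSpace ℝ F]
  {E : M → Type*} [TopologicalSpace (TotalSpace F E)]
  [∀ x, TopologicalSpace (E x)] [∀ x, AddCommGroup (E x)] [∀ x, Module ℝ (E x)]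
  [FiberBundle F E]

/-- For every nonzero tangent vector there is a global smooth function with nonvanishing derivative
along it. -/
lemma exists_smooth_mvfderiv_ne_zero {x : M} {v : TangentSpace 𝓘(ℝ, B) x} (hv : v ≠ 0) :
    ∃ f : Smooth B M, mvfderiv 𝓘(ℝ, B) f x v ≠ 0 := by
  have hinv := isInvertible_mfderiv_extChartAt (I := 𝓘(ℝ, B)) (x := x) (y := x)
    (mem_extChartAt_source x)
  -- Read `v` in the chart, detect it by a linear functional `φ`, and globalise `φ` composed with
  -- the chart by a bump function equal to 1 near `x`, which leaves the derivative at `x` unchanged.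
  let w : B := mfderiv 𝓘(ℝ, B) 𝓘(ℝ, B) (extChartAt 𝓘(ℝ, B) x) x v
  have hw : w ≠ 0 := fun h => hv (hinv.injective (h.trans (map_zero _).symm))
  obtain ⟨φ, hφ⟩ : ∃ φ : B →L[ℝ] ℝ, φ w ≠ 0 := by
    obtain ⟨φ, -, hφ⟩ := exists_dual_vector ℝ w (norm_ne_zero_iff.2 hw)
    exact ⟨φ, by rw [hφ]; simpa using hw⟩
  let ψ : SmoothBumpFunction 𝓘(ℝ, B) x := Classical.arbitrary _
  have hsm : ContMDiff 𝓘(ℝ, B) 𝓘(ℝ, ℝ) ∞ fun y => ψ y • φ (extChartAt 𝓘(ℝ, B) x y) :=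
    ψ.contMDiff_smul (φ.contMDiff.comp_contMDiffOn contMDiffOn_extChartAt)
  refine ⟨⟨_, hsm⟩, ?_⟩
  have heq : (fun y => ψ y • φ (extChartAt 𝓘(ℝ, B) x y)) =ᶠ[nhds x]
      φ ∘ extChartAt 𝓘(ℝ, B) x := by
    filter_upwards [ψ.eventuallyEq_one] with y hy
    simp [hy]
  have hd : mfderiv 𝓘(ℝ, B) 𝓘(ℝ, ℝ) (fun y => ψ y • φ (extChartAt 𝓘(ℝ, B) x y)) x =
      φ.comp (mfderiv 𝓘(ℝ, B) 𝓘(ℝ, B) (extChartAt 𝓘(ℝ, B) x) x) := by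
    rw [heq.mfderiv_eq, mfderiv_comp x φ.mdifferentiableAt
      (mdifferentiableAt_extChartAt (mem_chart_source B x))]
    congr 1
    exact φ.mfderiv_eq
  intro h0
  apply hφ
  rw [← h0]
  exact (DFunLike.congr_fun hd v).symm

variable [VectorBundle ℝ F E] [ContMDiffVectorBundle ∞ F E 𝓘(ℝ, B)]

/-- Every vector of a smooth vector bundle is the value of a global smooth section. -/
lemma exists_sec_apply_eq {x : M} (v : E x) : ∃ X : Sec B M F E, X x = v := by
  obtain ⟨s, hs, hsv⟩ := FiberBundle.exists_contMDiffOn_extend (k := ∞) 𝓘(ℝ, B) F v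
  obtain ⟨u, hus, hu, hxu⟩ := mem_nhds_iff.1 hs
  -- The local extension is smooth on `u`; a bump function with topological support in `u` extends
  -- it by zero and does not change its value at `x`.
  obtain ⟨ψ, -, hψ⟩ := (SmoothBumpFunction.nhds_basis_tsupport (I := 𝓘(ℝ, B)) x).mem_iff.1
    (hu.mem_nhds hxu)
  exact ⟨⟨_, ψ.contMDiff.contMDiffOn.smul_section_of_tsupport hu hψ (hsv.mono hus)⟩, by simp⟩

end Extension

/-! ### The components of `𝒩` and of its bracket with `l₁ + l₂ + l₃`. -/

section Bundles

variable {B : Type*} [NormedAddCommGroup B] [NormedSpace ℝ B]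
  {M : Type*} [TopologicalSpace M] [ChartedSpace B M] [IsManifold 𝓘(ℝ, B) ∞ M]
  {F : Type*} [NormedAddCommGroup F] [NormedSpace ℝ F] [FiniteDimensional ℝ F]
  {E : M → Type*} [TopologicalSpace (TotalSpace F E)]
  [∀ x, TopologicalSpace (E x)] [∀ x, AddCommGroup (E x)] [∀ x, Module ℝ (E x)]
  [FiberBundle F E] [VectorBundle ℝ F E] [ContMDiffVectorBundle ∞ F E 𝓘(ℝ, B)]
  {g : BundleMetric B F E} {C C' : CourantStructure g} {𝒩 : VForm (grading B M F E) 0}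

lemma tensorPart_smul (h𝒩 : IsSmoothLinear 𝒩) (f : Smooth B M) (X : Sec B M F E) :
    tensorPart 𝒩 (f • X) = f • tensorPart 𝒩 X := by
  have := h𝒩 1 ![(0, 0)] 0 f (0, X)
  simp only [update_one, Prod.smul_mk, smul_zero] at this
  exact congrArg Prod.snd this

lemma tensorPart_add (X Y : Sec B M F E) :
    tensorPart 𝒩 (X + Y) = tensorPart 𝒩 X + tensorPart 𝒩 Y := by
  have := (𝒩.form 1).map_update_add ![(0, 0)] 0 (0, X) (0, Y)
  simp only [update_one, Prod.mk_add_mk, add_zero] at this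
  exact congrArg Prod.snd this

lemma tensorPart_real_smul (c : ℝ) (X : Sec B M F E) :
    tensorPart 𝒩 (c • X) = c • tensorPart 𝒩 X := by
  have := (𝒩.form 1).map_update_smul ![(0, 0)] 0 c (0, X)
  simp only [update_one, Prod.smul_mk, smul_zero] at this
  exact congrArg Prod.snd this

lemma tensorPart_zero : tensorPart 𝒩 0 = 0 := by
  simpa using tensorPart_real_smul (𝒩 := 𝒩) 0 0

lemma twoFormPart_smul_right (h𝒩 : IsSmoothLinear 𝒩) (f : Smooth B M) (X Y : Sec B M F E) :
    twoFormPart 𝒩 X (f • Y) = f • twoFormPart 𝒩 X Y := by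
  have := h𝒩 2 ![(0, X), (0, 0)] 1 f (0, Y)
  have u1 : ∀ a b c : Smooth B M × Sec B M F E, Function.update ![a, b] 1 c = ![a, c] := by
    intro a b c; ext i <;> fin_cases i <;> rfl
  simp only [u1, Prod.smul_mk, smul_zero] at this
  exact congrArg Prod.fst this

/-- Sections have the odd degree `-1`, so graded symmetry means skew-symmetry on them. -/
lemma twoFormPart_skew (X Y : Sec B M F E) : twoFormPart 𝒩 X Y = -twoFormPart 𝒩 Y X := by
  have := 𝒩.symm 2 (fun _ => -1) ![(0, X), (0, Y)] (fun i => by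
    fin_cases i <;> exact mem_grading_neg_one rfl) (Equiv.swap 0 1)
  have hs : (fun i => ![((0 : Smooth B M), X), (0, Y)] (Equiv.swap 0 1 i)) = ![(0, Y), (0, X)] := by
    funext i; fin_cases i <;> rfl
  rw [hs] at this
  simpa [twoFormPart, koszulSign, Units.smul_def] using congrArg Prod.fst this

lemma form_zero : 𝒩.form 0 = 0 := form_eq_zero 𝒩 (by simp) (by simp)

/-- The bracket `[𝒩, l₁ + l₂ + l₃]` on functions. -/
lemma D_of_isRNBracket (h𝒩 : IsSmoothLinear 𝒩) (h : IsRNBracket 𝒩 C.lieTwo C'.lieTwo)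
    (f : Smooth B M) :
    C'.D f = C.D (functionPart 𝒩 * f) - tensorPart 𝒩 (C.D f) := by
  have := h 1 ![-2] ![(f, 0)] (fun i => by fin_cases i; exact mem_grading_neg_two rfl)
  rw [rnBracket, insertion_one form_zero, insertion_one rfl] at this
  have h1 : ∀ (C : CourantStructure g) (k : Smooth B M) (X : Sec B M F E),
      C.lieTwo.form 1 ![(k, X)] = (0, C.D k) := fun _ _ _ => rfl
  simp only [h1, form_one 𝒩 h𝒩] at this
  simpa using congrArg Prod.snd this

/-- The bracket `[𝒩, l₁ + l₂ + l₃]` on sections. -/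
lemma bracket_of_isRNBracket (h𝒩 : IsSmoothLinear 𝒩) (h : IsRNBracket 𝒩 C.lieTwo C'.lieTwo)
    (X Y : Sec B M F E) :
    C'.bracket X Y = C.deformedBracket (tensorPart 𝒩) X Y + C.D (twoFormPart 𝒩 X Y) := by
  have := h 2 ![-1, -1] ![(0, X), (0, Y)] (fun i => by
    fin_cases i <;> exact mem_grading_neg_one rfl)
  rw [rnBracket, insertion_two form_zero, insertion_two rfl] at this
  have h1 : ∀ (C : CourantStructure g) (k : Smooth B M) (X : Sec B M F E),
      C.lieTwo.form 1 ![(k, X)] = (0, C.D k) := fun _ _ _ => rfl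
  have h2 : ∀ (C : CourantStructure g) (k k' : Smooth B M) (X Y : Sec B M F E),
      C.lieTwo.form 2 ![(k, X), (k', Y)] =
        ((1 / 2 : ℝ) • (g.pair X (C.D k') + g.pair Y (C.D k)), C.bracket X Y) :=
    fun _ _ _ _ _ => rfl
  have hD : ∀ C : CourantStructure g, C.D 0 = 0 := fun _ => CourantStructure.grad_zero _
  simp only [h1, h2, form_one 𝒩 h𝒩, form_two] at this
  have := congrArg Prod.snd this
  simp [hD, Units.smul_def] at this
  -- The swap shuffle contributes `-[N Y, X]`, which skew-symmetry turns into `[X, N Y]`.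
  rw [this, C.skew (tensorPart 𝒩 Y) X, CourantStructure.deformedBracket]
  module

namespace CourantStructure

variable (C)

lemma D_mul (f h : Smooth B M) : C.D (f * h) = f • C.D h + h • C.D f := by
  refine g.pair_ext fun x w => ?_
  have hf := f.contMDiff.mdifferentiable (by simp) x
  have hh := h.contMDiff.mdifferentiable (by simp) x
  have := mvfderiv_mul hf hh
  simp [D, BundleMetric.grad, BundleMetric.gradAt_spec, this]

lemma D_one : C.D 1 = 0 := by
  have := C.D_mul 1 1
  simpa using this

end CourantStructure

/-- Evaluate `D' f = D (λ f) - N (D f)` at `f = 1`: both operators kill constants, so only `D λ`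
survives. -/
lemma D_functionPart (h𝒩 : IsSmoothLinear 𝒩) (h : IsRNBracket 𝒩 C.lieTwo C'.lieTwo) :
    C.D (functionPart 𝒩) = 0 := by
  have := D_of_isRNBracket h𝒩 h 1
  rw [C.D_one, C'.D_one, tensorPart_zero, sub_zero, mul_one] at this
  exact this.symm

lemma D_eq_of_isRNBracket (h𝒩 : IsSmoothLinear 𝒩) (h : IsRNBracket 𝒩 C.lieTwo C'.lieTwo)
    (f : Smooth B M) :
    C'.D f = functionPart 𝒩 • C.D f - tensorPart 𝒩 (C.D f) := by
  rw [D_of_isRNBracket h𝒩 h, C.D_mul, D_functionPart h𝒩 h, smul_zero, add_zero]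

/-! ### The symmetric defect and the comparison of Leibniz rules. -/

/-- The function `⟨N X, Y⟩ + ⟨X, N Y⟩ - λ ⟨X, Y⟩`, which measures the failure of
`N + N^* = λ Id`. -/
noncomputable def symmetricDefect (g : BundleMetric B F E) (𝒩 : VForm (grading B M F E) 0)
    (X Y : Sec B M F E) : Smooth B M :=
  g.pair (tensorPart 𝒩 X) Y + g.pair X (tensorPart 𝒩 Y) - functionPart 𝒩 * g.pair X Y

lemma symmetricDefect_comm (X Y : Sec B M F E) :
    symmetricDefect g 𝒩 X Y = symmetricDefect g 𝒩 Y X := by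
  rw [symmetricDefect, symmetricDefect, g.pair_comm X Y, g.pair_comm X, g.pair_comm _ Y,
    add_comm (g.pair Y _)]

lemma pair_grad_apply (f : Smooth B M) (X : Sec B M F E) (x : M) :
    g.val x (C.D f x) (X x) = mvfderiv 𝓘(ℝ, B) f x (C.anchor.val x (X x)) :=
  g.gradAt_spec C.anchor f x (X x)

/-- The Leibniz rule of the deformed structure, compared with that of the original one. -/
lemma symmetricDefect_smul_eq (h𝒩 : IsSmoothLinear 𝒩) (h : IsRNBracket 𝒩 C.lieTwo C'.lieTwo)
    (X Y : Sec B M F E) (f : Smooth B M) (x : M) :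
    symmetricDefect g 𝒩 X (C.D f) x • Y x =
      ((1 / 2 : ℝ) * symmetricDefect g 𝒩 X Y x - twoFormPart 𝒩 X Y x) • C.D f x := by
  have hL := C'.leibniz X Y f
  simp only [bracket_of_isRNBracket h𝒩 h, CourantStructure.deformedBracket,
    tensorPart_smul h𝒩, C.leibniz, twoFormPart_smul_right h𝒩, smul_eq_mul, C.D_mul] at hL
  have hneg : ∀ U W : Sec B M F E, tensorPart 𝒩 (U - W) = tensorPart 𝒩 U - tensorPart 𝒩 W := by
    intro U W
    rw [sub_eq_add_neg, tensorPart_add, ← neg_one_smul ℝ W, tensorPart_real_smul]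
    module
  simp only [hneg, tensorPart_add, tensorPart_real_smul, tensorPart_smul h𝒩] at hL
  -- With anchors expressed through `D f` and `D' f`, the formula for `D' f` eliminates the second
  -- structure. The terms `(ρ(X) f) N Y` and `½ ⟨X, Y⟩ N (D f)` then cancel, leaving multiples of
  -- `Y` and of `D f` only.
  have h1 : ∀ U, C.anchor.deriv U f = g.pair (C.D f) U := fun U => (g.pair_grad C.anchor f U).symm
  have h2 : C'.anchor.deriv X f = g.pair (C'.D f) X := (g.pair_grad C'.anchor f X).symm
  have h3 : g.grad C.anchor f = C.D f := rfl
  have h4 : g.grad C'.anchor f = C'.D f := rfl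
  rw [h2, h4, h3, D_eq_of_isRNBracket h𝒩 h] at hL
  simp only [h1] at hL
  have hx := DFunLike.congr_fun hL x
  have hp : ∀ U W : Sec B M F E, g.pair U W x = g.val x (U x) (W x) := fun _ _ => rfl
  simp [hp] at hx
  simp [symmetricDefect, hp]
  rw [g.symm x (tensorPart 𝒩 X x) (C.D f x), g.symm x (X x) (tensorPart 𝒩 (C.D f) x),
    g.symm x (X x) (C.D f x)]
  linear_combination (norm := module) hx

/-! ### Vanishing of `S` and `α`, and the new anchor. -/

variable [FiniteDimensional ℝ B] [T2Space M]

/-- At points where the anchor does not vanish the symmetric defect is twice the form `α`. -/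
lemma symmetricDefect_apply (h𝒩 : IsSmoothLinear 𝒩) (h : IsRNBracket 𝒩 C.lieTwo C'.lieTwo)
    {x : M} (hx : C.anchor.val x ≠ 0) (X Y : Sec B M F E) :
    (1 / 2 : ℝ) * symmetricDefect g 𝒩 X Y x = twoFormPart 𝒩 X Y x := by
  obtain ⟨v, hv⟩ : ∃ v, C.anchor.val x v ≠ 0 := by
    by_contra! h0
    exact hx (ContinuousLinearMap.ext h0)
  obtain ⟨Z, rfl⟩ := exists_sec_apply_eq (B := B) (F := F) v
  obtain ⟨f, hf⟩ := exists_smooth_mvfderiv_ne_zero hv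
  have hDf : C.D f x ≠ 0 := fun h0 => hf (by rw [← pair_grad_apply, h0]; simp)
  -- Since `ρ ∘ D = 0`, applying `ρ` leaves `S(X, D f) ρ(Z) = 0` at `x`, and `ρ(Z)` is nonzero
  -- there.
  have h1 := congrArg (C.anchor.val x) (symmetricDefect_smul_eq h𝒩 h X Z f x)
  rw [map_smul, map_smul, show C.anchor.val x (C.D f x) = 0 from C.anchor_grad f x, smul_zero,
    smul_eq_zero_iff_left hv] at h1
  -- The same `f` now serves for arbitrary `Y`: the left side is zero and `D f` is nonzero at `x`.
  have h2 := symmetricDefect_smul_eq h𝒩 h X Y f x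
  rw [h1, zero_smul, eq_comm, smul_eq_zero_iff_left hDf] at h2
  exact sub_eq_zero.1 h2

lemma symmetricDefect_eq (h𝒩 : IsSmoothLinear 𝒩) (h : IsRNBracket 𝒩 C.lieTwo C'.lieTwo)
    (hdense : Dense {x : M | C.anchor.val x ≠ 0}) (X Y : Sec B M F E) :
    (1 / 2 : ℝ) • symmetricDefect g 𝒩 X Y = twoFormPart 𝒩 X Y :=
  DFunLike.coe_injective <| Continuous.ext_on hdense (ContMDiffMap.contMDiff _).continuous
    (ContMDiffMap.contMDiff _).continuous fun _ hx => symmetricDefect_apply h𝒩 h hx X Y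

/-- By `symmetricDefect_eq`, `α` is half a symmetric form; being also skew, it vanishes. -/
lemma twoFormPart_eq_zero (h𝒩 : IsSmoothLinear 𝒩) (h : IsRNBracket 𝒩 C.lieTwo C'.lieTwo)
    (hdense : Dense {x : M | C.anchor.val x ≠ 0}) (X Y : Sec B M F E) :
    twoFormPart 𝒩 X Y = 0 := by
  have h1 := symmetricDefect_eq h𝒩 h hdense X Y
  rw [symmetricDefect_comm, symmetricDefect_eq h𝒩 h hdense] at h1
  have h2 := twoFormPart_skew (𝒩 := 𝒩) X Y
  rw [h1] at h2
  ext x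
  exact self_eq_neg.1 (DFunLike.congr_fun h2 x)

lemma symmetricDefect_eq_zero (h𝒩 : IsSmoothLinear 𝒩) (h : IsRNBracket 𝒩 C.lieTwo C'.lieTwo)
    (hdense : Dense {x : M | C.anchor.val x ≠ 0}) (X Y : Sec B M F E) :
    symmetricDefect g 𝒩 X Y = 0 := by
  have h1 := symmetricDefect_eq h𝒩 h hdense X Y
  rw [twoFormPart_eq_zero h𝒩 h hdense] at h1
  exact (smul_eq_zero.1 h1).resolve_left (by norm_num)

lemma anchor_of_isRNBracket (h𝒩 : IsSmoothLinear 𝒩) (h : IsRNBracket 𝒩 C.lieTwo C'.lieTwo)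
    (hdense : Dense {x : M | C.anchor.val x ≠ 0}) (X : Sec B M F E) (x : M) :
    C'.anchor.val x (X x) = C.anchor.val x (tensorPart 𝒩 X x) := by
  by_contra hne
  -- Global functions separate tangent vectors, so it is enough to compare derivatives: `⟨D' f, X⟩ =
  -- λ ⟨D f, X⟩ - ⟨N (D f), X⟩`, which is `⟨D f, N X⟩` because `S(D f, X) = 0`.
  obtain ⟨f, hf⟩ := exists_smooth_mvfderiv_ne_zero (sub_ne_zero.2 hne)
  apply hf
  rw [map_sub, ← pair_grad_apply, ← pair_grad_apply, D_eq_of_isRNBracket h𝒩 h]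
  have h0 := DFunLike.congr_fun (symmetricDefect_eq_zero h𝒩 h hdense (C.D f) X) x
  have hp : ∀ U W : Sec B M F E, g.pair U W x = g.val x (U x) (W x) := fun _ _ => rfl
  simp [symmetricDefect, hp] at h0
  simp
  linear_combination -h0

end Bundles

end CourantLie

theorem mainTheorem7
    {B : Type*} [NormedAddCommGroup B] [NormedSpace ℝ B] [FiniteDimensional ℝ B]
    {M : Type*} [TopologicalSpace M] [T2Space M] [ChartedSpace B M] [IsManifold 𝓘(ℝ, B) ∞ M]
    {F : Type*} [NormedAddCommGroup F] [NormedSpace ℝ F] [FiniteDimensional ℝ F]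
    {E : M → Type*} [TopologicalSpace (TotalSpace F E)]
    [∀ x, TopologicalSpace (E x)] [∀ x, AddCommGroup (E x)] [∀ x, Module ℝ (E x)]
    [FiberBundle F E] [VectorBundle ℝ F E] [ContMDiffVectorBundle ∞ F E 𝓘(ℝ, B)]
    (g : CourantLie.BundleMetric B F E)
    (C : CourantLie.CourantStructure g)
    (hdense : Dense {x : M | C.anchor.val x ≠ 0})
    (𝒩 : CourantLie.VForm (CourantLie.grading B M F E) 0)
    (h𝒩 : CourantLie.IsSmoothLinear 𝒩)
    (C' : CourantLie.CourantStructure g)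
    (hC' : CourantLie.IsRNBracket 𝒩 C.lieTwo C'.lieTwo) :
    C.IsCasimir (CourantLie.functionPart 𝒩) ∧
    (∀ X Y, CourantLie.twoFormPart 𝒩 X Y = 0) ∧
    (∃ Nstar : CourantLie.Sec B M F E → CourantLie.Sec B M F E,
      (∀ X Y, g.pair (CourantLie.tensorPart 𝒩 X) Y = g.pair X (Nstar Y)) ∧
      ∀ X, CourantLie.tensorPart 𝒩 X + Nstar X = CourantLie.functionPart 𝒩 • X) ∧
    (∀ X Y, C'.bracket X Y = C.deformedBracket (CourantLie.tensorPart 𝒩) X Y) ∧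
    (∀ (X : CourantLie.Sec B M F E) (x : M),
      C'.anchor.val x (X x) = C.anchor.val x (CourantLie.tensorPart 𝒩 X x)) := by

  have hs := CourantLie.symmetricDefect_eq_zero h𝒩 hC' hdense
  have hα := CourantLie.twoFormPart_eq_zero h𝒩 hC' hdense
  -- The transpose is taken to be `λ - N`, so the sum formula is immediate and the adjunction
  -- property is exactly `S = 0`.
  refine ⟨fun X => ?_, hα, ⟨fun X => CourantLie.functionPart 𝒩 • X - CourantLie.tensorPart 𝒩 X,
    fun X Y => ?_, fun X => add_sub_cancel _ _⟩, fun X Y => ?_,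
    CourantLie.anchor_of_isRNBracket h𝒩 hC' hdense⟩
  · rw [← g.pair_grad]
    exact (congrArg (g.pair · X) (CourantLie.D_functionPart h𝒩 hC')).trans
      (CourantLie.CourantStructure.pair_zero_left X)
  · ext x
    have h0 := DFunLike.congr_fun (hs X Y) x
    have hp : ∀ U W : CourantLie.Sec B M F E, g.pair U W x = g.val x (U x) (W x) :=
      fun _ _ => rfl
    simp [CourantLie.symmetricDefect, hp] at h0
    simp [hp]
    linear_combination h0
  · rw [CourantLie.bracket_of_isRNBracket h𝒩 hC', hα]
    exact (congrArg _ (CourantLie.CourantStructure.grad_zero _)).trans (add_zero _)
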